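/- Setting. Let $(M,P_0,P_1)$ be a Gel'fand--Zakharevich bi-Hamiltonian manifold: $M$ is a smooth real manifold, $P_0$ and all $P_\lambda=P_1-\lambda P_0$ ($\lambda\in\mathbb R$) are Poisson tensors, viewed as maps $P:T^*M\to TM$ with $\{F,G\}_P=\langle dF,P\,dG\rangle$, and there are nontrivial polynomial Casimirs $H^a(\lambda)=\sum_{l=0}^{n_a}\lambda^{n_a-l}H^a_l$, $n_a\ge 1$, $a=1,\dots,k$, with $(P_1-\lambda P_0)\,dH^a(\lambda)=0$, and common Casimirs $K_1,\dots,K_r$ of $P_0$ and $P_1$, such that all the functions $H^a_l,K_j$ are functionally independent (their differentials are linearly independent on a dense subset of $M$) and $P_0$ and $P_1$ both have corank $k+r$ on a dense subset. Put $C_a=H^a_0$; these are Casimirs of $P_0$. Let $Z_1,\dots,Z_k$ be smooth vector fields on $M$ with $Z_a(C_b)=\delta_{ab}$ and $Z_a(K_j)=0$, such that the (locally defined) functions invariant along all the $Z_a$ (briefly, $\mathcal Z$-invariant functions) form a Poisson algebra for the pencil. Let $S$ be a generic symplectic leaf of $P_0$, that is, a leaf along which $P_0$ has corank $k+r$ and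 $dC_1,\dots,dC_k,dK_1,\dots,dK_r$ are linearly independent. The deformed tensor $$\widetilde P_1=P_1-\sum_{a=1}^k X_a\wedge Z_a,\qquad X_a=P_1\,dC_a,$$ restricts to $S$; let $N=\widetilde P_1|_S\circ(P_0|_S)^{-1}$ be the induced Nijenhuis tensor on $S$, and let $N^*\alpha=\alpha\circ N$. Let $\Gamma(\lambda,\mu)$ be a polynomial in $\lambda,\mu$, of bounded degree, whose coefficients are smooth complex functions on $M$, and which is a generating function of Casimirs of the pencil: $(P_1-\lambda P_0)\,d\Gamma(\lambda,\mu)=0$ for all $\lambda,\mu\in\mathbb C$. Let $U\subseteq M$ be open, and suppose that $\Gamma(\lambda,\mu)=0$ defines a smooth affine algebraic curve in $\mathbb C^2$ at every point of $S\cap U$. Proposition. Let $f$ be a smooth complex function on $U$ that is $\mathcal Z$-invariant, $Z_a(f)=0$ for $a=1,\dots,k$, and whose restriction to $S$ satisfies $N^*df=f\,df$ on $S\cap U$. Let $g$ be a smooth $\mathcal Z$-invariant complex function on $U$ with $\Gamma(f,g)=0$ (that is, $\lambda=f$, $\mu=g$), and suppose that at every point of $S\cap U$ the point $(\lambda,\mu)=(f,g)$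 of the curve $\Gamma(\lambda,\mu)=0$ is generic, that is, it is not a ramification point of the projection of the curve to the $\lambda$-line. Then the restriction of $g$ to $S$ satisfies $$N^*dg=f\,dg\qquad\text{on } S\cap U .$$ -/

import Mathlib

open scoped Manifold ContDiff

noncomputable section

namespace BiHamiltonian

/-! ### Bivector fields and Poisson tensors -/

section Poisson

variable {E : Type*} [NormedAddCommGroup E] [NormedSpace ℝ E]
  {M : Type*} [TopologicalSpace M] [ChartedSpace E M]

/-- A (not necessarily smooth) field of bivectors on `M`, as a field of skew-symmetric linear maps
`T*_p M → T_p M`; the value of the bivector on a pair of covectors is `P(α, β) = α (P β)`. -/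
structure Bivector (E : Type*) [NormedAddCommGroup E] [NormedSpace ℝ E]
    (M : Type*) [TopologicalSpace M] [ChartedSpace E M] where
  /-- the map `T*_p M → T_p M` -/
  sharp (p : M) : (TangentSpace 𝓘(ℝ, E) p →L[ℝ] ℝ) →ₗ[ℝ] TangentSpace 𝓘(ℝ, E) p
  skew (p : M) (α β : TangentSpace 𝓘(ℝ, E) p →L[ℝ] ℝ) : α (sharp p β) = -β (sharp p α)

/-- The bracket `{F, G}_P = dF (P dG)`. -/
def bracket (P : Bivector E M) (F G : M → ℝ) (p : M) : ℝ :=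
  mvfderiv 𝓘(ℝ, E) F p (P.sharp p (mvfderiv 𝓘(ℝ, E) G p))

/-- A Poisson tensor: the bracket maps smooth functions to smooth functions (that is, the bivector
field is smooth) and satisfies the Jacobi identity. -/
structure IsPoisson (P : Bivector E M) : Prop where
  smooth : ∀ F G : M → ℝ, ContMDiff 𝓘(ℝ, E) 𝓘(ℝ, ℝ) ∞ F → ContMDiff 𝓘(ℝ, E) 𝓘(ℝ, ℝ) ∞ G →
    ContMDiff 𝓘(ℝ, E) 𝓘(ℝ, ℝ) ∞ (bracket P F G)
  jacobi : ∀ F G K : M → ℝ, ContMDiff 𝓘(ℝ, E) 𝓘(ℝ, ℝ) ∞ F → ContMDiff 𝓘(ℝ, E) 𝓘(ℝ, ℝ) ∞ G →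
    ContMDiff 𝓘(ℝ, E) 𝓘(ℝ, ℝ) ∞ K → ∀ p,
    bracket P F (bracket P G K) p + bracket P G (bracket P K F) p
      + bracket P K (bracket P F G) p = 0

/-- The element `P₁ - c P₀` of the pencil. -/
def pencil (P₀ P₁ : Bivector E M) (c : ℝ) : Bivector E M where
  sharp p := P₁.sharp p - c • P₀.sharp p
  skew p α β := by
    simp only [LinearMap.sub_apply, LinearMap.smul_apply, map_sub, map_smul, smul_eq_mul]
    rw [P₁.skew p α β, P₀.skew p α β]
    ring

/-- `P₀`, `P₁` define a Poisson pencil (a bi-Hamiltonian structure). -/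
def IsPoissonPencil (P₀ P₁ : Bivector E M) : Prop :=
  IsPoisson P₀ ∧ ∀ c : ℝ, IsPoisson (pencil P₀ P₁ c)

/-- `F` is a Casimir function of `P`. -/
def IsCasimir (P : Bivector E M) (F : M → ℝ) : Prop :=
  ∀ p, P.sharp p (mvfderiv 𝓘(ℝ, E) F p) = 0

/-- The complex function `F` is a Casimir of `P₁ - c P₀` for a complex value `c` of the parameter,
`(P₁ - c P₀) dF = 0`. The vector `(P₁ - c P₀) dF` of the complexified tangent space is tested
against the real covectors `β`, and `β (P dF) = - dF (P β)` by skew-symmetry. -/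
def IsPencilCasimir (P₀ P₁ : Bivector E M) (c : ℂ) (F : M → ℂ) : Prop :=
  ∀ (p : M) (β : TangentSpace 𝓘(ℝ, E) p →L[ℝ] ℝ),
    mvfderiv 𝓘(ℝ, E) F p (P₁.sharp p β) - c * mvfderiv 𝓘(ℝ, E) F p (P₀.sharp p β) = 0

/-! ### Gel'fand-Zakharevich manifolds, transversal distributions, deformed tensor -/

/-- `(M, P₀, P₁)` is a Gel'fand-Zakharevich bi-Hamiltonian manifold with `k` nontrivial polynomial
Casimirs `H^a(c) = ∑_{l ≤ deg a} c ^ (deg a - l) H^a_l` and `r` trivial (common) Casimirs `K_j`: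
the (generic) coranks of `P₀` and `P₁` are both equal to the number `k + r` of polynomial Casimirs,
whose coefficients are functionally independent. The leading coefficients `H^a_0` are
Casimirs of `P₀`. -/
structure IsGelfandZakharevich (P₀ P₁ : Bivector E M) {k r : ℕ} (deg : Fin k → ℕ)
    (H : (a : Fin k) → Fin (deg a + 1) → M → ℝ) (K : Fin r → M → ℝ) : Prop where
  isPoissonPencil : IsPoissonPencil P₀ P₁
  deg_pos : ∀ a, 0 < deg a
  smooth_H : ∀ a l, ContMDiff 𝓘(ℝ, E) 𝓘(ℝ, ℝ) ∞ (H a l)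
  smooth_K : ∀ j, ContMDiff 𝓘(ℝ, E) 𝓘(ℝ, ℝ) ∞ (K j)
  casimir_H : ∀ (c : ℝ) (a : Fin k),
    IsCasimir (pencil P₀ P₁ c) (fun p => ∑ l : Fin (deg a + 1), c ^ (deg a - (l : ℕ)) * H a l p)
  casimir_K : ∀ j, IsCasimir P₀ (K j) ∧ IsCasimir P₁ (K j)
  corank : Dense {p : M | Module.finrank ℝ (LinearMap.ker (P₀.sharp p)) = k + r ∧
    Module.finrank ℝ (LinearMap.ker (P₁.sharp p)) = k + r}
  independent : Dense {p : M | LinearIndependent ℝ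
    (Sum.elim (fun x : (a : Fin k) × Fin (deg a + 1) => mvfderiv 𝓘(ℝ, E) (H x.1 x.2) p)
      (fun j : Fin r => mvfderiv 𝓘(ℝ, E) (K j) p))}

/-- The function `F` is invariant on `U` along the fields `Z_a`. -/
def IsInvariantOn {k : ℕ} (Z : Fin k → (p : M) → TangentSpace 𝓘(ℝ, E) p) {V : Type*}
    [NormedAddCommGroup V] [NormedSpace ℝ V] (F : M → V) (U : Set M) : Prop :=
  ∀ p ∈ U, ∀ a, mvfderiv 𝓘(ℝ, E) F p (Z a p) = 0

/-- The fields `Z_1, …, Z_k` generate a transversal distribution for the pencil, normalized with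
respect to the nontrivial Casimirs `C_1, …, C_k` of `P₀`: `Z_a(C_b) = δ_ab`, `Z_a(K_j) = 0` for the
common Casimirs, and the (locally defined) functions invariant along the `Z_a` form a Poisson
algebra for the pencil. -/
structure IsTransversal (P₀ P₁ : Bivector E M) [IsManifold 𝓘(ℝ, E) ∞ M] {k r : ℕ}
    (C : Fin k → M → ℝ) (K : Fin r → M → ℝ)
    (Z : Fin k → (p : M) → TangentSpace 𝓘(ℝ, E) p) : Prop where
  smooth : ∀ a, ContMDiff 𝓘(ℝ, E) (𝓘(ℝ, E).prod 𝓘(ℝ, E)) ∞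
    (fun p => (⟨p, Z a p⟩ : TangentBundle 𝓘(ℝ, E) M))
  normalized : ∀ a b p, mvfderiv 𝓘(ℝ, E) (C b) p (Z a p) = if a = b then 1 else 0
  common : ∀ a j p, mvfderiv 𝓘(ℝ, E) (K j) p (Z a p) = 0
  poissonAlgebra : ∀ (c : ℝ) (U : Set M), IsOpen U → ∀ F G : M → ℝ,
    ContMDiffOn 𝓘(ℝ, E) 𝓘(ℝ, ℝ) ∞ F U → ContMDiffOn 𝓘(ℝ, E) 𝓘(ℝ, ℝ) ∞ G U →
    IsInvariantOn Z F U → IsInvariantOn Z G U →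
    IsInvariantOn Z (bracket P₀ F G) U ∧ IsInvariantOn Z (bracket (pencil P₀ P₁ c) F G) U

/-- The bivector `X ∧ Z`, `(X ∧ Z)(α, β) = α(X) β(Z) - α(Z) β(X)`. -/
def wedge (X Z : (p : M) → TangentSpace 𝓘(ℝ, E) p) : Bivector E M where
  sharp p :=
    { toFun := fun β => β (Z p) • X p - β (X p) • Z p
      map_add' := fun β γ => by
        simp only [add_apply, add_smul]
        abel
      map_smul' := fun c β => by
        simp only [smul_apply, smul_eq_mul, mul_smul, smul_sub,
          RingHom.id_apply] }
  skew p α β := by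
    simp only [LinearMap.coe_mk, AddHom.coe_mk, map_sub, map_smul, smul_eq_mul]
    ring

/-- The deformed tensor `P₁ - ∑_a X_a ∧ Z_a`, where `X_a = P₁ dC_a`. -/
def deformed (P₁ : Bivector E M) {k : ℕ} (C : Fin k → M → ℝ)
    (Z : Fin k → (p : M) → TangentSpace 𝓘(ℝ, E) p) : Bivector E M where
  sharp p := P₁.sharp p
    - ∑ a, (wedge (fun q => P₁.sharp q (mvfderiv 𝓘(ℝ, E) (C a) q)) (Z a)).sharp p
  skew p α β := by
    simp only [LinearMap.sub_apply, LinearMap.sum_apply, map_sub, map_sum]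
    rw [P₁.skew p α β, Finset.sum_congr rfl fun a _ => (wedge (fun q =>
      P₁.sharp q (mvfderiv 𝓘(ℝ, E) (C a) q)) (Z a)).skew p α β]
    simp only [Finset.sum_neg_distrib]
    ring

/-! ### Symplectic leaves -/

/-- One segment of a Hamiltonian trajectory of `P` leads from `x` to `y`. -/
def HamiltonianSegment (P : Bivector E M) (x y : M) : Prop :=
  ∃ (h : M → ℝ) (γ : ℝ → M) (a b : ℝ), ContMDiff 𝓘(ℝ, E) 𝓘(ℝ, ℝ) ∞ h ∧ a ≤ b ∧
    IsMIntegralCurveOn γ (fun p => P.sharp p (mvfderiv 𝓘(ℝ, E) h p)) (Set.Icc a b) ∧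
    γ a = x ∧ γ b = y

/-- The set of points that can be joined to `x` by a chain of Hamiltonian trajectories. -/
def leafThrough (P : Bivector E M) (x : M) : Set M :=
  {y | Relation.EqvGen (HamiltonianSegment P) x y}

variable {F : Type*} [NormedAddCommGroup F] [NormedSpace ℝ F]
  {S : Type*} [TopologicalSpace S] [ChartedSpace F S]

variable (F) in
/-- The injective immersion `ι : S → M` is a symplectic leaf of `P`: its image is the set of points
that can be reached from one of them by Hamiltonian trajectories, and the tangent spaces of `S` are
spanned by the Hamiltonian vector fields. -/
structure IsSymplecticLeaf (P : Bivector E M) (ι : S → M) : Prop where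
  smooth : ContMDiff 𝓘(ℝ, F) 𝓘(ℝ, E) ∞ ι
  injective : Function.Injective ι
  immersion : ∀ s, Function.Injective (mfderiv 𝓘(ℝ, F) 𝓘(ℝ, E) ι s)
  tangent : ∀ s, LinearMap.range (mfderiv 𝓘(ℝ, F) 𝓘(ℝ, E) ι s).toLinearMap
    = LinearMap.range (P.sharp (ι s))
  leaf : ∃ x, Set.range ι = leafThrough P x

/-- The leaf is generic: along it the tensor `P` has corank `k + r`, and the `k` nontrivial
Casimirs `C_a` and the `r` trivial ones `K_j` are independent. -/
def IsGenericLeaf (P : Bivector E M) {k r : ℕ} (C : Fin k → M → ℝ) (K : Fin r → M → ℝ)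
    (ι : S → M) : Prop :=
  ∀ s, Module.finrank ℝ (LinearMap.ker (P.sharp (ι s))) = k + r ∧
    LinearIndependent ℝ (Sum.elim (fun a : Fin k => mvfderiv 𝓘(ℝ, E) (C a) (ι s))
      (fun j : Fin r => mvfderiv 𝓘(ℝ, E) (K j) (ι s)))

/-! ### Restriction of bivectors to a leaf, and the Nijenhuis tensor -/

/-- The map `Q : T*_s S → T_s S` is the restriction of `P` at the point `s` of `S`, that is,
`dι ∘ Q ∘ (dι)* = P`. -/
def IsRestrictionAt (P : Bivector E M) (ι : S → M) (s : S)
    (Q : (TangentSpace 𝓘(ℝ, F) s →L[ℝ] ℝ) →ₗ[ℝ] TangentSpace 𝓘(ℝ, F) s) : Prop :=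
  ∀ β : TangentSpace 𝓘(ℝ, E) (ι s) →L[ℝ] ℝ,
    mfderiv 𝓘(ℝ, F) 𝓘(ℝ, E) ι s (Q (β ∘L mfderiv 𝓘(ℝ, F) 𝓘(ℝ, E) ι s)) = P.sharp (ι s) β

open Classical in
/-- The restriction of `P` to `S` (zero by convention where `P` does not restrict). -/
def restrictTo (P : Bivector E M) (ι : S → M) (s : S) :
    (TangentSpace 𝓘(ℝ, F) s →L[ℝ] ℝ) →ₗ[ℝ] TangentSpace 𝓘(ℝ, F) s :=
  if h : ∃ Q, IsRestrictionAt P ι s Q then h.choose else 0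

open Classical in
/-- The inverse of a linear map (zero by convention if the map is not bijective). -/
def linearInverse {V W : Type*} [AddCommGroup V] [Module ℝ V] [AddCommGroup W] [Module ℝ W]
    (Q : V →ₗ[ℝ] W) : W →ₗ[ℝ] V :=
  if h : Function.Bijective Q then (LinearEquiv.ofBijective Q h).symm.toLinearMap else 0

/-- The Nijenhuis tensor `N = (P₁|S) ∘ (P₀|S)⁻¹` on `S`. -/
def nijenhuisTensor (P₀ P₁ : Bivector E M) (ι : S → M) (s : S) :
    TangentSpace 𝓘(ℝ, F) s →ₗ[ℝ] TangentSpace 𝓘(ℝ, F) s :=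
  restrictTo P₁ ι s ∘ₗ linearInverse (restrictTo P₀ ι s)

/-- The complex function `h` on `S` satisfies `N* dh = c dh` at `s`, where `N* α = α ∘ N`. -/
def AdjointEigenAt (N : (s : S) → TangentSpace 𝓘(ℝ, F) s →ₗ[ℝ] TangentSpace 𝓘(ℝ, F) s)
    (h : S → ℂ) (c : ℂ) (s : S) : Prop :=
  ∀ v : TangentSpace 𝓘(ℝ, F) s,
    mvfderiv 𝓘(ℝ, F) h s (N s v) = c * mvfderiv 𝓘(ℝ, F) h s v

end Poisson

/-! ### Families of plane algebraic curves -/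

section Curves

/-- The value `q(lam, mu)` of a polynomial in two variables. -/
def evalAt (q : MvPolynomial (Fin 2) ℂ) (lam mu : ℂ) : ℂ := MvPolynomial.eval ![lam, mu] q

/-- The plane affine curve `q(lam, mu) = 0` is a smooth algebraic curve. -/
def IsSmoothCurve (q : MvPolynomial (Fin 2) ℂ) : Prop :=
  q.totalDegree ≠ 0 ∧ ∀ lam mu : ℂ, evalAt q lam mu = 0 →
    evalAt (MvPolynomial.pderiv 0 q) lam mu ≠ 0 ∨ evalAt (MvPolynomial.pderiv 1 q) lam mu ≠ 0

/-- `(v, w)` is tangent to the curve `q = 0` at `(lam, mu)`. -/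
def IsTangent (q : MvPolynomial (Fin 2) ℂ) (lam mu v w : ℂ) : Prop :=
  evalAt (MvPolynomial.pderiv 0 q) lam mu * v + evalAt (MvPolynomial.pderiv 1 q) lam mu * w = 0

/-- A ramification point of the smooth curve `q = 0`, seen as a covering of the `lam`-line: the
differential of the projection `(lam, mu) ↦ lam` vanishes on the tangent line of the curve. -/
def IsRamificationPoint (q : MvPolynomial (Fin 2) ℂ) (lam mu : ℂ) : Prop :=
  evalAt q lam mu = 0 ∧ ∀ v w : ℂ, IsTangent q lam mu v w → v = 0

/-- A generic point of the curve: one that is not a ramification point of the `lam`-projection. -/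
def IsGenericCurvePoint (q : MvPolynomial (Fin 2) ℂ) (lam mu : ℂ) : Prop :=
  evalAt q lam mu = 0 ∧ ¬ IsRamificationPoint q lam mu

variable {E : Type*} [NormedAddCommGroup E] [NormedSpace ℝ E]
  {M : Type*} [TopologicalSpace M] [ChartedSpace E M]

/-- A polynomial in two variables whose coefficients are smooth complex functions on `M`. -/
structure IsSmoothFamily (E : Type*) [NormedAddCommGroup E] [NormedSpace ℝ E]
    {M : Type*} [TopologicalSpace M] [ChartedSpace E M]
    (Γ : M → MvPolynomial (Fin 2) ℂ) : Prop where
  degree : ∃ d, ∀ p, (Γ p).totalDegree ≤ d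
  smooth : ∀ m, ContMDiff 𝓘(ℝ, E) 𝓘(ℝ, ℂ) ∞ (fun p => (Γ p).coeff m)

/-- `Γ(lam, mu)` is a generating function of Casimirs of the pencil:
`(P₁ - lam P₀) dΓ(lam, mu) = 0` for all values of the parameters. -/
def IsCasimirGenerating (P₀ P₁ : Bivector E M) (Γ : M → MvPolynomial (Fin 2) ℂ) : Prop :=
  ∀ lam mu : ℂ, IsPencilCasimir P₀ P₁ lam (fun p => evalAt (Γ p) lam mu)

end Curves

end BiHamiltonian

end

open BiHamiltonian

/-!
The proof is pointwise. At a point `p = ι s` with `ι s ∈ U` let `φ` be the differential of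
`Γ(lam, mu)` with the parameters frozen at `lam = f p`, `mu = g p`. Differentiating `Γ(f, g) = 0`
gives `φ + Γ_lam df + Γ_mu dg = 0` (`mvfderiv_evalAt`), and `Γ_mu ≠ 0` because the curve is smooth
and `(f, g)` is not a ramification point (`IsGenericCurvePoint.pderiv_ne_zero`). Hence `dg` is a
combination of `df` and `φ`, and it suffices that `φ` too is an eigencovector of `N*` for `f p`.

Since `f` and `g` are invariant along the `Z_a`, the relation shows that `φ` annihilates the `Z_a`.
The generating property says `φ ∘ P₁ = f φ ∘ P₀` on covectors, so `φ` also annihilates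
`X_a = P₁ dC_a`, the `C_a` being Casimirs of `P₀`; therefore `P₁` may be replaced by the deformed
tensor in this identity (`apply_deformed_of_pencil`).

To descend to the leaf, the deformed tensor must take values in the tangent spaces of `S`
(`range_deformed_le`). By the corank condition, the range of `P₀` on `S` is the common annihilator
of the `dC_a` and `dK_j` (`mem_range_of_skew`), and these vanish on the values of the deformed
tensor thanks to the normalization of the `Z_a` and the involutivity of the `C_a`, which comes from
the Lenard relations `P₀ dH_0 = 0`, `P₁ dH_0 = P₀ dH_1` (`lenard_relations`). Then every tangent
vector of `S` is `P₀ β` for a covector `β` of `M`, and `N` maps it to the value of the deformed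
tensor on `β` (`exists_sharp_eq_nijenhuisTensor`), which turns the identities on `M` into
identities on `S`.
-/

namespace BiHamiltonian

/-! ### Directional derivatives of complex functions -/

section Calculus

variable {E : Type*} [NormedAddCommGroup E] [NormedSpace ℝ E]
  {M : Type*} [TopologicalSpace M] [ChartedSpace E M]

/-- The complex function `h` is differentiable at `p`, with derivative `a` in the direction `v`. -/
def HasDirDeriv (h : M → ℂ) (p : M) (v : TangentSpace 𝓘(ℝ, E) p) (a : ℂ) : Prop :=
  MDifferentiableAt 𝓘(ℝ, E) 𝓘(ℝ, ℂ) h p ∧ mvfderiv 𝓘(ℝ, E) h p v = a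

variable {p : M} {v : TangentSpace 𝓘(ℝ, E) p} {h h₁ h₂ : M → ℂ} {a a₁ a₂ : ℂ}

theorem HasDirDeriv.const (c : ℂ) : HasDirDeriv (fun _ : M => c) p v 0 :=
  ⟨mdifferentiableAt_const, by rw [mvfderiv_const]; rfl⟩

theorem HasDirDeriv.add (H₁ : HasDirDeriv h₁ p v a₁) (H₂ : HasDirDeriv h₂ p v a₂) :
    HasDirDeriv (fun q => h₁ q + h₂ q) p v (a₁ + a₂) :=
  ⟨H₁.1.add H₂.1, by rw [mvfderiv_fun_add H₁.1 H₂.1, ← H₁.2, ← H₂.2]; rfl⟩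

theorem HasDirDeriv.mul (H₁ : HasDirDeriv h₁ p v a₁) (H₂ : HasDirDeriv h₂ p v a₂) :
    HasDirDeriv (fun q => h₁ q * h₂ q) p v (a₁ * h₂ p + h₁ p * a₂) := by
  refine ⟨H₁.1.mul H₂.1, ?_⟩
  have := (H₁.1.hasMFDerivAt.mul H₂.1.hasMFDerivAt).mfderiv
  have h2 := congrArg (fun L => L v) this
  rw [← H₁.2, ← H₂.2, add_comm]
  refine h2.trans ?_
  change h₁ p * _ + h₂ p * _ = _
  rw [mul_comm (h₂ p)]
  rfl

theorem HasDirDeriv.pow (H : HasDirDeriv h p v a) (n : ℕ) :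
    HasDirDeriv (fun q => h q ^ n) p v (n * h p ^ (n - 1) * a) := by
  induction n with
  | zero => simpa using HasDirDeriv.const (p := p) (v := v) 1
  | succ n ih =>
    simp only [pow_succ]
    convert ih.mul H using 1
    rcases n with _ | n
    · simp
    · push_cast
      simp only [pow_succ]
      ring

theorem HasDirDeriv.sum {I : Type*} (A : Finset I) {h : I → M → ℂ} {a : I → ℂ}
    (H : ∀ i ∈ A, HasDirDeriv (h i) p v (a i)) :
    HasDirDeriv (fun q => ∑ i ∈ A, h i q) p v (∑ i ∈ A, a i) := by
  classical
  induction A using Finset.induction_on with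
  | empty => simpa using HasDirDeriv.const (p := p) (v := v) 0
  | insert i s hi ih =>
    simp only [Finset.sum_insert hi]
    exact (H i (by simp)).add (ih fun j hj => H j (by simp [hj]))

end Calculus

/-! ### Differentiating along a family of plane curves -/

section Curves

/-- A polynomial whose support lies in `A`, written out as a sum of monomials. -/
theorem evalAt_eq_sum {q : MvPolynomial (Fin 2) ℂ} {A : Finset (Fin 2 →₀ ℕ)} (hA : q.support ⊆ A)
    (lam mu : ℂ) : evalAt q lam mu = ∑ m ∈ A, q.coeff m * lam ^ m 0 * mu ^ m 1 := by
  rw [evalAt, MvPolynomial.eval_eq']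
  simp only [Fin.prod_univ_two, Matrix.cons_val_zero, Matrix.cons_val_one, ← mul_assoc]
  refine Finset.sum_subset hA fun m _ hm => ?_
  rw [MvPolynomial.notMem_support_iff.mp hm]
  simp

/-- The partial derivatives of a polynomial whose support lies in `A`. At an exponent `0` the
truncated subtraction is harmless, since the factor `m i` vanishes. -/
theorem evalAt_pderiv_eq_sum {q : MvPolynomial (Fin 2) ℂ} {A : Finset (Fin 2 →₀ ℕ)}
    (hA : q.support ⊆ A) (lam mu : ℂ) :
    evalAt (MvPolynomial.pderiv 0 q) lam mu
        = ∑ m ∈ A, q.coeff m * (m 0 * lam ^ (m 0 - 1)) * mu ^ m 1 ∧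
      evalAt (MvPolynomial.pderiv 1 q) lam mu
        = ∑ m ∈ A, q.coeff m * lam ^ m 0 * (m 1 * mu ^ (m 1 - 1)) := by
  have hq : q = ∑ m ∈ A, MvPolynomial.monomial m (q.coeff m) := by
    conv_lhs => rw [← MvPolynomial.support_sum_monomial_coeff q]
    refine Finset.sum_subset hA fun m _ hm => ?_
    rw [MvPolynomial.notMem_support_iff.mp hm, map_zero]
  constructor
  all_goals
    rw [evalAt]
    conv_lhs => rw [hq]
    rw [map_sum, map_sum]
    refine Finset.sum_congr rfl fun m _ => ?_
    rw [MvPolynomial.pderiv_monomial, MvPolynomial.eval_monomial,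
      Finsupp.prod_fintype _ _ (by simp)]
    simp [Fin.prod_univ_two]
    ring

/-- At a point of a smooth curve that is not a ramification point of the projection to the
`lam`-line, the derivative of the equation in the direction of `mu` does not vanish. -/
theorem IsGenericCurvePoint.pderiv_ne_zero {q : MvPolynomial (Fin 2) ℂ} (hq : IsSmoothCurve q)
    {lam mu : ℂ} (h : IsGenericCurvePoint q lam mu) :
    evalAt (MvPolynomial.pderiv 1 q) lam mu ≠ 0 := by
  intro h1
  refine h.2 ⟨h.1, fun v w ht => ?_⟩
  have h0 := (hq.2 lam mu h.1).resolve_right (not_not.mpr h1)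
  rw [IsTangent, h1, zero_mul, add_zero] at ht
  exact (mul_eq_zero.mp ht).resolve_left h0

variable {E : Type*} [NormedAddCommGroup E] [NormedSpace ℝ E]
  {M : Type*} [TopologicalSpace M] [ChartedSpace E M]

theorem IsSmoothFamily.exists_support_subset {Γ : M → MvPolynomial (Fin 2) ℂ}
    (hΓ : IsSmoothFamily E Γ) : ∃ A : Finset (Fin 2 →₀ ℕ), ∀ p, (Γ p).support ⊆ A := by
  obtain ⟨d, hd⟩ := hΓ.degree
  refine ⟨(Finsupp.finite_of_degree_le (σ := Fin 2) d).toFinset, fun p m hm => ?_⟩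
  rw [Set.Finite.mem_toFinset]
  refine le_trans (le_of_eq ?_) ((MvPolynomial.le_totalDegree hm).trans (hd p))
  rfl

/-- Chain rule for `Γ(f, g)`: the total derivative is the derivative of the coefficients at the
frozen values of `f` and `g`, plus the contributions of `f` and `g`. -/
theorem mvfderiv_evalAt {Γ : M → MvPolynomial (Fin 2) ℂ} (hΓ : IsSmoothFamily E Γ)
    {f g : M → ℂ} {p : M} (hf : MDifferentiableAt 𝓘(ℝ, E) 𝓘(ℝ, ℂ) f p)
    (hg : MDifferentiableAt 𝓘(ℝ, E) 𝓘(ℝ, ℂ) g p) (v : TangentSpace 𝓘(ℝ, E) p) :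
    mvfderiv 𝓘(ℝ, E) (fun q => evalAt (Γ q) (f q) (g q)) p v
      = mvfderiv 𝓘(ℝ, E) (fun q => evalAt (Γ q) (f p) (g p)) p v
        + evalAt (MvPolynomial.pderiv 0 (Γ p)) (f p) (g p) * mvfderiv 𝓘(ℝ, E) f p v
        + evalAt (MvPolynomial.pderiv 1 (Γ p)) (f p) (g p) * mvfderiv 𝓘(ℝ, E) g p v := by
  obtain ⟨A, hA⟩ := hΓ.exists_support_subset
  have hc : ∀ m, HasDirDeriv (fun q => (Γ q).coeff m) p v
      (mvfderiv 𝓘(ℝ, E) (fun q => (Γ q).coeff m) p v) := fun m =>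
    ⟨(hΓ.smooth m).mdifferentiableAt (by simp), rfl⟩
  have key : ∀ {F G : M → ℂ} {a b : ℂ}, HasDirDeriv F p v a → HasDirDeriv G p v b →
      mvfderiv 𝓘(ℝ, E) (fun q => evalAt (Γ q) (F q) (G q)) p v = _ := fun {F G a b} HF HG => by
    simp only [fun q => evalAt_eq_sum (hA q)]
    exact (HasDirDeriv.sum A fun m _ => ((hc m).mul (HF.pow (m 0))).mul (HG.pow (m 1))).2
  rw [key ⟨hf, rfl⟩ ⟨hg, rfl⟩, key (HasDirDeriv.const (f p)) (HasDirDeriv.const (g p)),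
    (evalAt_pderiv_eq_sum (hA p) _ _).1, (evalAt_pderiv_eq_sum (hA p) _ _).2,
    Finset.sum_mul, Finset.sum_mul, ← Finset.sum_add_distrib, ← Finset.sum_add_distrib]
  refine Finset.sum_congr rfl fun m _ => ?_
  ring

end Curves

/-! ### Skew maps from covectors to vectors -/

section LinearAlgebra

variable {V W : Type*} [AddCommGroup V] [Module ℝ V] [TopologicalSpace V] [IsTopologicalAddGroup V]
  [ContinuousSMul ℝ V] [T2Space V] [FiniteDimensional ℝ V]
  [AddCommGroup W] [Module ℝ W] [TopologicalSpace W]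

theorem exists_continuous_functional_of_notMem {p : Submodule ℝ V} {v : V} (hv : v ∉ p) :
    ∃ β : V →L[ℝ] ℝ, β v ≠ 0 ∧ ∀ w ∈ p, β w = 0 := by
  obtain ⟨φ, hφ, hp⟩ := Submodule.exists_le_ker_of_notMem hv
  exact ⟨LinearMap.toContinuousLinearMap φ, hφ, fun w hw => hp hw⟩

theorem eq_zero_of_forall_continuous_functional {v : V} (h : ∀ β : V →L[ℝ] ℝ, β v = 0) :
    v = 0 := by
  by_contra hv
  obtain ⟨β, hβ, -⟩ := exists_continuous_functional_of_notMem (p := (⊥ : Submodule ℝ V)) (v := v)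
    (by simpa using hv)
  exact hβ (h β)

/-- A skew map `P : V* → V` vanishes on the covectors that annihilate its range. -/
theorem skew_apply_eq_zero {P : (V →L[ℝ] ℝ) →ₗ[ℝ] V} (hP : ∀ α β : V →L[ℝ] ℝ, α (P β) = -β (P α))
    {β : V →L[ℝ] ℝ} (hβ : ∀ v ∈ LinearMap.range P, β v = 0) : P β = 0 :=
  eq_zero_of_forall_continuous_functional fun γ => by
    rw [hP, hβ _ (LinearMap.mem_range_self P γ), neg_zero]

/-- A vector annihilated by a family of covectors spanning the kernel of a skew map `P` lies in the
range of `P`. -/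
theorem mem_range_of_skew {P : (V →L[ℝ] ℝ) →ₗ[ℝ] V} (hP : ∀ α β : V →L[ℝ] ℝ, α (P β) = -β (P α))
    {I : Type*} [Fintype I] {φ : I → V →L[ℝ] ℝ} (hφ : LinearIndependent ℝ φ)
    (hker : ∀ i, P (φ i) = 0) (hcard : Module.finrank ℝ (LinearMap.ker P) = Fintype.card I)
    {v : V} (hv : ∀ i, φ i v = 0) : v ∈ LinearMap.range P := by
  by_contra hn
  obtain ⟨β, hβv, hβ⟩ := exists_continuous_functional_of_notMem hn
  have : FiniteDimensional ℝ (V →L[ℝ] ℝ) :=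
    Module.Finite.of_injective (ContinuousLinearMap.coeLM ℝ : (V →L[ℝ] ℝ) →ₗ[ℝ] V →ₗ[ℝ] ℝ)
      ContinuousLinearMap.coe_injective
  have hspan : Submodule.span ℝ (Set.range φ) = LinearMap.ker P :=
    Submodule.eq_of_le_of_finrank_eq
      (Submodule.span_le.mpr (Set.range_subset_iff.mpr hker))
      (by rw [finrank_span_eq_card hφ, hcard])
  have hmem : β ∈ Submodule.span ℝ (Set.range φ) := by
    rw [hspan]
    exact skew_apply_eq_zero hP hβ
  refine hβv ?_
  clear hβv hβ
  induction hmem using Submodule.span_induction with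
  | mem x hx => obtain ⟨i, rfl⟩ := hx; exact hv i
  | zero => rfl
  | add x y _ _ hx hy => simp [hx, hy]
  | smul c x _ hx => simp [hx]

variable [IsTopologicalAddGroup W] [ContinuousSMul ℝ W]

/-- A covector on a subspace extends. -/
theorem exists_comp_eq {ι : W →L[ℝ] V} (hι : Function.Injective ι)
    (α : W →L[ℝ] ℝ) : ∃ β : V →L[ℝ] ℝ, β ∘L ι = α := by
  obtain ⟨L, hL⟩ := ι.toLinearMap.exists_leftInverse_of_injective (LinearMap.ker_eq_bot.mpr hι)
  refine ⟨α ∘L LinearMap.toContinuousLinearMap L, ?_⟩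
  ext w
  exact congrArg α (LinearMap.congr_fun hL w)

/-- A skew map `V* → V` with values in the image of an injection `ι : W → V` restricts to `W`. -/
theorem exists_restriction {P : (V →L[ℝ] ℝ) →ₗ[ℝ] V} (hP : ∀ α β : V →L[ℝ] ℝ, α (P β) = -β (P α))
    {ι : W →L[ℝ] V} (hι : Function.Injective ι)
    (hr : LinearMap.range P ≤ LinearMap.range ι.toLinearMap) :
    ∃ Q : (W →L[ℝ] ℝ) →ₗ[ℝ] W, ∀ β : V →L[ℝ] ℝ, ι (Q (β ∘L ι)) = P β := by
  obtain ⟨L, hL⟩ := ι.toLinearMap.exists_leftInverse_of_injective (LinearMap.ker_eq_bot.mpr hι)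
  have hL' : ∀ w, L (ι w) = w := fun w => LinearMap.congr_fun hL w
  let T : (W →L[ℝ] ℝ) →ₗ[ℝ] (V →L[ℝ] ℝ) :=
    { toFun := fun α => α ∘L LinearMap.toContinuousLinearMap L
      map_add' := fun _ _ => rfl
      map_smul' := fun _ _ => rfl }
  refine ⟨L ∘ₗ P ∘ₗ T, fun β => ?_⟩
  have h1 : P (T (β ∘L ι)) = P β := by
    rw [← sub_eq_zero, ← map_sub]
    refine skew_apply_eq_zero hP fun v hv => ?_
    obtain ⟨w, rfl⟩ := hr hv
    change β (ι (L (ι w))) - β (ι w) = 0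
    rw [hL', sub_self]
  obtain ⟨w, hw⟩ := hr (LinearMap.mem_range_self P β)
  change ι (L (P (T (β ∘L ι)))) = P β
  rw [h1, ← hw]
  exact congrArg ι (hL' w)

/-- If the range of `P` is the whole image of `W`, its restriction to `W` is nondegenerate. -/
theorem bijective_of_restriction {P : (V →L[ℝ] ℝ) →ₗ[ℝ] V}
    (hP : ∀ α β : V →L[ℝ] ℝ, α (P β) = -β (P α))
    {ι : W →L[ℝ] V} (hι : Function.Injective ι)
    (hr : LinearMap.range ι.toLinearMap = LinearMap.range P)
    {Q : (W →L[ℝ] ℝ) →ₗ[ℝ] W} (hQ : ∀ β : V →L[ℝ] ℝ, ι (Q (β ∘L ι)) = P β) :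
    Function.Bijective Q := by
  constructor
  · refine (injective_iff_map_eq_zero Q).mpr fun α hα => ?_
    obtain ⟨β, rfl⟩ := exists_comp_eq hι α
    have h0 : P β = 0 := by rw [← hQ, hα, map_zero]
    ext w
    obtain ⟨γ, hγ⟩ : ι w ∈ LinearMap.range P := hr ▸ LinearMap.mem_range_self ι.toLinearMap w
    change β (ι w) = 0
    rw [← hγ, hP, h0, map_zero, neg_zero]
  · intro w
    obtain ⟨β, hβ⟩ : ι w ∈ LinearMap.range P := hr ▸ LinearMap.mem_range_self ι.toLinearMap w
    exact ⟨β ∘L ι, hι ((hQ β).trans hβ)⟩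

end LinearAlgebra

/-! ### The Lenard relations -/

section Geometry

variable {E : Type*} [NormedAddCommGroup E] [NormedSpace ℝ E]
  {M : Type*} [TopologicalSpace M] [ChartedSpace E M]

theorem mvfderiv_sum_const_mul {I : Type*} (A : Finset I) (c : I → ℝ) {h : I → M → ℝ} {p : M}
    (hh : ∀ i ∈ A, MDifferentiableAt 𝓘(ℝ, E) 𝓘(ℝ, ℝ) (h i) p) :
    MDifferentiableAt 𝓘(ℝ, E) 𝓘(ℝ, ℝ) (fun q => ∑ i ∈ A, c i * h i q) p ∧
    mvfderiv 𝓘(ℝ, E) (fun q => ∑ i ∈ A, c i * h i q) p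
      = ∑ i ∈ A, c i • mvfderiv 𝓘(ℝ, E) (h i) p := by
  classical
  induction A using Finset.induction_on with
  | empty =>
    simp only [Finset.sum_empty]
    exact ⟨mdifferentiableAt_const, mvfderiv_const _⟩
  | insert i s hi ih =>
    obtain ⟨h1, h2⟩ := ih fun j hj => hh j (by simp [hj])
    have hd := hh i (by simp)
    have hm : MDifferentiableAt 𝓘(ℝ, E) 𝓘(ℝ, ℝ) (fun q => c i * h i q) p :=
      mdifferentiableAt_const.mul hd
    simp only [Finset.sum_insert hi]
    refine ⟨hm.add h1, ?_⟩
    rw [mvfderiv_fun_add hm h1, h2, mvfderiv_fun_mul mdifferentiableAt_const hd, mvfderiv_const,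
      smul_zero, add_zero]

section Lenard

variable [FiniteDimensional ℝ E]

instance finiteDimensional_tangentSpace (p : M) : FiniteDimensional ℝ (TangentSpace 𝓘(ℝ, E) p) :=
  inferInstanceAs (FiniteDimensional ℝ E)

instance t2Space_tangentSpace (p : M) : T2Space (TangentSpace 𝓘(ℝ, E) p) :=
  inferInstanceAs (T2Space E)

/-- The first two Lenard relations `P₀ dH_0 = 0`, `P₁ dH_0 = P₀ dH_1` for a nonconstant polynomial
Casimir `H_0 c ^ n + H_1 c ^ (n - 1) + ⋯` of the pencil: they are the two leading coefficients of
`(P₁ - c P₀) dH(c) = 0`. -/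
theorem lenard_relations {P₀ P₁ : Bivector E M} {n : ℕ} (hn : 0 < n) {H : Fin (n + 1) → M → ℝ}
    (hH : ∀ l, ContMDiff 𝓘(ℝ, E) 𝓘(ℝ, ℝ) ∞ (H l))
    (hcas : ∀ c : ℝ, IsCasimir (pencil P₀ P₁ c)
      (fun p => ∑ l : Fin (n + 1), c ^ (n - (l : ℕ)) * H l p)) (p : M) :
    P₀.sharp p (mvfderiv 𝓘(ℝ, E) (H 0) p) = 0 ∧
    P₁.sharp p (mvfderiv 𝓘(ℝ, E) (H 0) p)
      = P₀.sharp p (mvfderiv 𝓘(ℝ, E) (H ⟨1, by omega⟩) p) := by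
  have hpoly : ∀ β : TangentSpace 𝓘(ℝ, E) p →L[ℝ] ℝ,
      (∑ l : Fin (n + 1), (Polynomial.monomial (n - (l : ℕ))
          (β (P₁.sharp p (mvfderiv 𝓘(ℝ, E) (H l) p)))
        - Polynomial.monomial (n - (l : ℕ) + 1)
          (β (P₀.sharp p (mvfderiv 𝓘(ℝ, E) (H l) p))))) = 0 := by
    intro β
    refine Polynomial.funext fun c => ?_
    have h := hcas c p
    rw [(mvfderiv_sum_const_mul Finset.univ (fun l : Fin (n + 1) => c ^ (n - (l : ℕ)))
      fun l _ => (hH l).mdifferentiableAt (by simp)).2] at h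
    have h := congrArg β h
    rw [map_sum, map_sum, map_zero] at h
    rw [Polynomial.eval_finsetSum, Polynomial.eval_zero, ← h]
    refine Finset.sum_congr rfl fun l _ => ?_
    simp only [Polynomial.eval_sub, Polynomial.eval_monomial, map_smul, pencil,
      LinearMap.sub_apply, LinearMap.smul_apply, map_sub, smul_eq_mul, pow_succ]
    ring
  -- in degree `n + 1` only `P₀ dH_0` contributes, in degree `n` only `P₁ dH_0` and `P₀ dH_1`
  constructor
  · refine eq_zero_of_forall_continuous_functional fun β => ?_
    have h := congrArg (fun q => q.coeff (n + 1)) (hpoly β)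
    simp only [Polynomial.finsetSum_coeff, Polynomial.coeff_sub, Polynomial.coeff_monomial,
      Polynomial.coeff_zero] at h
    rw [Finset.sum_eq_single 0 (fun l _ hl => by
      have : (l : ℕ) ≠ 0 := fun h0 => hl (Fin.ext h0)
      rw [if_neg (by omega), if_neg (by omega), sub_zero]) (by simp)] at h
    rw [if_neg (by simp), if_pos (by simp), zero_sub, neg_eq_zero] at h
    exact h
  · rw [← sub_eq_zero]
    refine eq_zero_of_forall_continuous_functional fun β => ?_
    have h := congrArg (fun q => q.coeff n) (hpoly β)
    simp only [Polynomial.finsetSum_coeff, Polynomial.coeff_sub, Polynomial.coeff_monomial,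
      Polynomial.coeff_zero, Finset.sum_sub_distrib] at h
    rw [Finset.sum_eq_single 0 (fun l _ hl => by
        have : (l : ℕ) ≠ 0 := fun h0 => hl (Fin.ext h0)
        rw [if_neg (by omega)]) (by simp),
      Finset.sum_eq_single ⟨1, by omega⟩ (fun l _ hl => by
        have : (l : ℕ) ≠ 1 := fun h0 => hl (Fin.ext h0)
        rw [if_neg (by omega)]) (by simp),
      if_pos (by simp), if_pos (by simp; omega)] at h
    rw [map_sub]
    exact h

end Lenard

end Geometry

/-! ### The deformed tensor on a symplectic leaf -/

section Leaf

variable {E : Type*} [NormedAddCommGroup E] [NormedSpace ℝ E]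
  {M : Type*} [TopologicalSpace M] [ChartedSpace E M]

theorem deformed_sharp_apply (P₁ : Bivector E M) {k : ℕ} (C : Fin k → M → ℝ)
    (Z : Fin k → (p : M) → TangentSpace 𝓘(ℝ, E) p) (p : M)
    (β : TangentSpace 𝓘(ℝ, E) p →L[ℝ] ℝ) :
    (deformed P₁ C Z).sharp p β = P₁.sharp p β - ∑ a,
      (β (Z a p) • P₁.sharp p (mvfderiv 𝓘(ℝ, E) (C a) p)
        - β (P₁.sharp p (mvfderiv 𝓘(ℝ, E) (C a) p)) • Z a p) := by
  change (P₁.sharp p - ∑ a, _) β = _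
  rw [LinearMap.sub_apply, LinearMap.sum_apply]
  rfl

/-- On a covector `φ` of the kernel of `P₁ - c P₀` that annihilates the `Z_a`, the deformation of
`P₁` is invisible, because `φ` also annihilates the `X_a = P₁ dC_a`. -/
theorem apply_deformed_of_pencil {P₀ P₁ : Bivector E M} {k : ℕ} {C : Fin k → M → ℝ}
    {Z : Fin k → (p : M) → TangentSpace 𝓘(ℝ, E) p} {p : M}
    (hC : ∀ a, P₀.sharp p (mvfderiv 𝓘(ℝ, E) (C a) p) = 0)
    {c : ℂ} {φ : TangentSpace 𝓘(ℝ, E) p →L[ℝ] ℂ}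
    (hφ : ∀ β, φ (P₁.sharp p β) = c * φ (P₀.sharp p β)) (hφZ : ∀ a, φ (Z a p) = 0)
    (β : TangentSpace 𝓘(ℝ, E) p →L[ℝ] ℝ) :
    φ ((deformed P₁ C Z).sharp p β) = c * φ (P₀.sharp p β) := by
  have hX : ∀ a, φ (P₁.sharp p (mvfderiv 𝓘(ℝ, E) (C a) p)) = 0 := fun a => by
    rw [hφ, hC, map_zero, mul_zero]
  rw [deformed_sharp_apply, map_sub, map_sum, hφ]
  simp only [map_sub, map_smul, hX, hφZ, smul_zero, sub_zero, Finset.sum_const_zero]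

variable [FiniteDimensional ℝ E]

/-- The deformed tensor is tangent to the generic symplectic leaves of `P₀`: its values are
annihilated by the differentials of all the Casimirs `C_a`, `K_j` of `P₀`. -/
theorem range_deformed_le [IsManifold 𝓘(ℝ, E) ∞ M] {P₀ P₁ : Bivector E M} {k r : ℕ}
    {deg : Fin k → ℕ} {H : (a : Fin k) → Fin (deg a + 1) → M → ℝ} {K : Fin r → M → ℝ}
    (hGZ : IsGelfandZakharevich P₀ P₁ deg H K)
    {Z : Fin k → (p : M) → TangentSpace 𝓘(ℝ, E) p}
    (hZ : IsTransversal P₀ P₁ (fun a => H a 0) K Z) {S : Type*} {ι : S → M}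
    (hSgen : IsGenericLeaf P₀ (fun a => H a 0) K ι) (s : S) :
    LinearMap.range ((deformed P₁ (fun a => H a 0) Z).sharp (ι s))
      ≤ LinearMap.range (P₀.sharp (ι s)) := by
  have hL := fun a => lenard_relations (hGZ.deg_pos a) (hGZ.smooth_H a)
    (fun c => hGZ.casimir_H c a) (ι s)
  -- the `C_a` are in involution for `P₁`, since `P₁ dC_a = P₀ dH^a_1` and `P₀ dC_b = 0`
  have hinv : ∀ a b, mvfderiv 𝓘(ℝ, E) (H b 0) (ι s)
      (P₁.sharp (ι s) (mvfderiv 𝓘(ℝ, E) (H a 0) (ι s))) = 0 := fun a b => by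
    rw [(hL a).2, P₀.skew, (hL b).1, map_zero, neg_zero]
  rintro _ ⟨β, rfl⟩
  refine mem_range_of_skew (P₀.skew (ι s)) (hSgen s).2 ?_ ?_ ?_
  · rintro (a | j)
    · exact (hL a).1
    · exact (hGZ.casimir_K j).1 (ι s)
  · rw [(hSgen s).1]
    simp
  · rintro (b | j)
    · simp only [Sum.elim_inl]
      rw [deformed_sharp_apply, map_sub, map_sum]
      simp only [map_sub, map_smul, hinv, hZ.normalized, smul_eq_mul, mul_zero, zero_sub, mul_ite,
        mul_one, Finset.sum_neg_distrib, Finset.sum_ite_eq', Finset.mem_univ, if_true]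
      rw [P₁.skew]
      ring
    · have hK : ∀ γ, mvfderiv 𝓘(ℝ, E) (K j) (ι s) (P₁.sharp (ι s) γ) = 0 := fun γ => by
        rw [P₁.skew, (hGZ.casimir_K j).2 (ι s), map_zero, neg_zero]
      simp only [Sum.elim_inr]
      rw [deformed_sharp_apply, map_sub, map_sum]
      simp only [map_sub, map_smul, hK, hZ.common, smul_zero, sub_zero, Finset.sum_const_zero]

variable {F : Type*} [NormedAddCommGroup F] [NormedSpace ℝ F]
  {S : Type*} [TopologicalSpace S] [ChartedSpace F S]

/-- If `P` restricts at `s`, then `restrictTo` is such a restriction, not the default value. -/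
theorem isRestrictionAt_restrictTo {P : Bivector E M} {ι : S → M} {s : S}
    (hι : Function.Injective (mfderiv 𝓘(ℝ, F) 𝓘(ℝ, E) ι s))
    (hr : LinearMap.range (P.sharp (ι s))
      ≤ LinearMap.range (mfderiv 𝓘(ℝ, F) 𝓘(ℝ, E) ι s).toLinearMap) :
    IsRestrictionAt (F := F) P ι s (restrictTo P ι s) := by
  have h : ∃ Q, IsRestrictionAt (F := F) P ι s Q := exists_restriction (P.skew (ι s)) hι hr
  rw [restrictTo, dif_pos h]
  exact h.choose_spec

/-- The tensor `N = P₁|S ∘ (P₀|S)⁻¹` seen from `M`: each tangent vector of `S` is `P₀ β` for some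
covector `β` of `M`, and `N` sends it to `P₁ β`. -/
theorem exists_sharp_eq_nijenhuisTensor {P₀ P₁ : Bivector E M} {ι : S → M}
    (hS : IsSymplecticLeaf F P₀ ι) {s : S}
    (hr : LinearMap.range (P₁.sharp (ι s)) ≤ LinearMap.range (P₀.sharp (ι s)))
    (v : TangentSpace 𝓘(ℝ, F) s) :
    ∃ β : TangentSpace 𝓘(ℝ, E) (ι s) →L[ℝ] ℝ,
      mfderiv 𝓘(ℝ, F) 𝓘(ℝ, E) ι s v = P₀.sharp (ι s) β ∧
      mfderiv 𝓘(ℝ, F) 𝓘(ℝ, E) ι s (nijenhuisTensor P₀ P₁ ι s v) = P₁.sharp (ι s) β := by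
  have hι := hS.immersion s
  have h₀ := isRestrictionAt_restrictTo (P := P₀) hι (hS.tangent s).ge
  have h₁ := isRestrictionAt_restrictTo (P := P₁) hι (hr.trans (hS.tangent s).ge)
  have hbij : Function.Bijective (restrictTo P₀ ι s) :=
    bijective_of_restriction (P₀.skew (ι s)) hι (hS.tangent s) h₀
  obtain ⟨α, rfl⟩ := hbij.2 v
  obtain ⟨β, rfl⟩ := exists_comp_eq hι α
  refine ⟨β, h₀ β, ?_⟩
  rw [nijenhuisTensor, LinearMap.comp_apply, linearInverse, dif_pos hbij, ← h₁ β]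
  exact congrArg (fun x => mfderiv 𝓘(ℝ, F) 𝓘(ℝ, E) ι s (restrictTo P₁ ι s x))
    ((LinearEquiv.ofBijective _ hbij).symm_apply_apply _)

end Leaf

end BiHamiltonian

open BiHamiltonian
theorem mainTheorem1
    {E : Type*} [NormedAddCommGroup E] [NormedSpace ℝ E] [FiniteDimensional ℝ E]
    {M : Type*} [TopologicalSpace M] [T2Space M] [SecondCountableTopology M]
    [ChartedSpace E M] [IsManifold 𝓘(ℝ, E) ∞ M]
    {F : Type*} [NormedAddCommGroup F] [NormedSpace ℝ F] [FiniteDimensional ℝ F]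
    {S : Type*} [TopologicalSpace S] [ChartedSpace F S] [IsManifold 𝓘(ℝ, F) ∞ S]
    -- the Gel'fand-Zakharevich manifold and its polynomial Casimirs
    (P₀ P₁ : Bivector E M) {k r : ℕ} (deg : Fin k → ℕ)
    (H : (a : Fin k) → Fin (deg a + 1) → M → ℝ) (K : Fin r → M → ℝ)
    (hGZ : IsGelfandZakharevich P₀ P₁ deg H K)
    -- the transversal distribution
    (Z : Fin k → (p : M) → TangentSpace 𝓘(ℝ, E) p)
    (hZ : IsTransversal P₀ P₁ (fun a => H a 0) K Z)
    -- the generic symplectic leaf and its Nijenhuis tensor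
    (ι : S → M) (hS : IsSymplecticLeaf F P₀ ι)
    (hSgen : IsGenericLeaf P₀ (fun a => H a 0) K ι)
    (N : (s : S) → TangentSpace 𝓘(ℝ, F) s →ₗ[ℝ] TangentSpace 𝓘(ℝ, F) s)
    (hN : N = nijenhuisTensor P₀ (deformed P₁ (fun a => H a 0) Z) ι)
    -- the family of curves
    (Γ : M → MvPolynomial (Fin 2) ℂ) (hΓ : IsSmoothFamily E Γ)
    (hΓcas : IsCasimirGenerating P₀ P₁ Γ)
    -- the functions, defined on an open set
    (U : Set M) (hU : IsOpen U) (hΓsmooth : ∀ s, ι s ∈ U → IsSmoothCurve (Γ (ι s)))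
    (f g : M → ℂ)
    (hf : ContMDiffOn 𝓘(ℝ, E) 𝓘(ℝ, ℂ) ∞ f U) (hg : ContMDiffOn 𝓘(ℝ, E) 𝓘(ℝ, ℂ) ∞ g U)
    (hfZ : IsInvariantOn Z f U)
    (hfN : ∀ s, ι s ∈ U → AdjointEigenAt N (f ∘ ι) (f (ι s)) s)
    (hgZ : IsInvariantOn Z g U)
    (hfg : ∀ p ∈ U, evalAt (Γ p) (f p) (g p) = 0)
    (hgeneric : ∀ s, ι s ∈ U → IsGenericCurvePoint (Γ (ι s)) (f (ι s)) (g (ι s))) :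
    ∀ s, ι s ∈ U → AdjointEigenAt N (g ∘ ι) (f (ι s)) s := by
  intro s hs v
  have hι : MDifferentiableAt 𝓘(ℝ, F) 𝓘(ℝ, E) ι s := hS.smooth.mdifferentiableAt (by simp)
  have hfd : MDifferentiableAt 𝓘(ℝ, E) 𝓘(ℝ, ℂ) f (ι s) :=
    (hf.contMDiffAt (hU.mem_nhds hs)).mdifferentiableAt (by simp)
  have hgd : MDifferentiableAt 𝓘(ℝ, E) 𝓘(ℝ, ℂ) g (ι s) :=
    (hg.contMDiffAt (hU.mem_nhds hs)).mdifferentiableAt (by simp)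
  have hΓμ := (hgeneric s hs).pderiv_ne_zero (hΓsmooth s hs)
  set Γμ := evalAt (MvPolynomial.pderiv 1 (Γ (ι s))) (f (ι s)) (g (ι s))
  set Γl := evalAt (MvPolynomial.pderiv 0 (Γ (ι s))) (f (ι s)) (g (ι s))
  -- the differential of `Γ` at the frozen values of `f` and `g`
  set φ := mvfderiv 𝓘(ℝ, E) (fun q => evalAt (Γ q) (f (ι s)) (g (ι s))) (ι s)
  -- differentiating `Γ(f, g) = 0`
  have hrel : ∀ w : TangentSpace 𝓘(ℝ, E) (ι s),
      φ w + Γl * mvfderiv 𝓘(ℝ, E) f (ι s) w + Γμ * mvfderiv 𝓘(ℝ, E) g (ι s) w = 0 := by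
    intro w
    rw [← mvfderiv_evalAt hΓ hfd hgd w]
    have h0 : (fun q => evalAt (Γ q) (f q) (g q)) =ᶠ[nhds (ι s)] fun _ => (0 : ℂ) :=
      Filter.eventually_of_mem (hU.mem_nhds hs) hfg
    exact DFunLike.congr_fun ((hasMFDerivAt_const (I := 𝓘(ℝ, E)) (I' := 𝓘(ℝ, ℂ)) (0 : ℂ)
      (ι s)).congr_of_eventuallyEq h0).mfderiv w
  have hφ : ∀ β, φ (P₁.sharp (ι s) β) = f (ι s) * φ (P₀.sharp (ι s) β) := fun β =>
    sub_eq_zero.mp (hΓcas (f (ι s)) (g (ι s)) (ι s) β)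
  -- the invariance of `f` and `g` passes to `φ`
  have hφZ : ∀ a, φ (Z a (ι s)) = 0 := fun a => by
    have h := hrel (Z a (ι s))
    rwa [hfZ _ hs a, hgZ _ hs a, mul_zero, mul_zero, add_zero, add_zero] at h
  obtain ⟨β, hβ₀, hβ₁⟩ := exists_sharp_eq_nijenhuisTensor hS
    (range_deformed_le hGZ hZ hSgen s) v
  have hfv := hfN s hs v
  subst hN
  have hcomp : ∀ {h : M → ℂ}, MDifferentiableAt 𝓘(ℝ, E) 𝓘(ℝ, ℂ) h (ι s) →
      ∀ w, mvfderiv 𝓘(ℝ, F) (h ∘ ι) s w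
        = mvfderiv 𝓘(ℝ, E) h (ι s) (mfderiv 𝓘(ℝ, F) 𝓘(ℝ, E) ι s w) :=
    fun hh w => mfderiv_comp_apply s hh hι w
  rw [hcomp hfd, hcomp hfd, hβ₀, hβ₁] at hfv
  rw [hcomp hgd, hcomp hgd, hβ₀, hβ₁]
  have hφβ := apply_deformed_of_pencil (fun a => (lenard_relations (hGZ.deg_pos a) (hGZ.smooth_H a)
    (fun c => hGZ.casimir_H c a) (ι s)).1) hφ hφZ β
  -- `Γμ dg = -(φ + Γl df)`, and both `φ` and `df` satisfy the required identity on `β`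
  refine mul_left_cancel₀ hΓμ ?_
  linear_combination hrel ((deformed P₁ (fun a => H a 0) Z).sharp (ι s) β)
    - f (ι s) * hrel (P₀.sharp (ι s) β) - hφβ - Γl * hfv
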